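/- Let $(a(m))_{m\ge 0}$ be the Stern sequence, defined by $a(0)=0$, $a(1)=1$, $a(2m)=a(m)$ and $a(2m+1)=a(m)+a(m+1)$, and let $s(m)=a(m+1)$ for $m\ge 0$. A record-setter of $s$ is an integer $v\ge 0$ such that $s(i)<s(v)$ for all $0\le i<v$; it is identified with its base-2 representation, written without leading zeros and with the most significant digit first. For a string $x$ and an integer $j\ge 0$, let $x^j$ denote the concatenation of $j$ copies of $x$. Theorem. Let $n\ge 5$. The record-setters of $s$ whose base-2 representation has length $2n+3$ are exactly those with the following base-2 representations: $$\begin{cases} 1000\,(10)^{n-1}\,0,\\ 100\,100\,(10)^{n-3}\,0\,10,\\ 100\,100\,(10)^{n-2}\,0,\\ 100\,(10)^{i}\,0\,(10)^{n-i-1}\,0, & \text{for } 1<i\le \left\lceil \frac{n-1}{2}\right\rceil,\\ (10)^{i+1}\,0\,(10)^{n-i}, & \text{for } 0\le i\le n. \end{cases}$$ -/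

import Mathlib

/-- The Stern sequence: `a(0) = 0`, `a(1) = 1`, `a(2m) = a(m)`, `a(2m+1) = a(m) + a(m+1)`. -/
def stern : ℕ → ℕ
  | 0 => 0
  | 1 => 1
  | n + 2 =>
    if n % 2 = 0 then stern (n / 2 + 1)
    else stern (n / 2 + 1) + stern (n / 2 + 2)
decreasing_by all_goals omega

theorem stern_zero : stern 0 = 0 := by rw [stern]

theorem stern_one : stern 1 = 1 := by rw [stern]

theorem stern_two_mul (m : ℕ) : stern (2 * m) = stern m := by
  cases m with
  | zero => rfl
  | succ k =>
    rw [show 2 * (k + 1) = 2 * k + 2 by ring, stern, if_pos (by omega)]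
    congr 1
    omega

theorem stern_two_mul_add_one (m : ℕ) : stern (2 * m + 1) = stern m + stern (m + 1) := by
  cases m with
  | zero => simp [stern_zero, stern_one]
  | succ k =>
    rw [show 2 * (k + 1) + 1 = (2 * k + 1) + 2 by ring, stern, if_neg (by omega)]
    congr 2 <;> omega

/-- The shifted Stern sequence `s(n) = a(n+1)`. -/
def sternShift (n : ℕ) : ℕ := stern (n + 1)

/-- `v` is a record-setter of the sequence `f`: `f i < f v` for all `i < v`. -/
def IsRecordSetter (f : ℕ → ℕ) (v : ℕ) : Prop := ∀ i < v, f i < f v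

/-- The base-2 representation of `v`, without leading zeros, most significant digit first. -/
def binaryString (v : ℕ) : List ℕ := (Nat.digits 2 v).reverse

/-- The repetition `x ^ i = x x ⋯ x` (`i` copies) of a string `x`. -/
def strPow (x : List ℕ) (i : ℕ) : List ℕ := (List.replicate i x).flatten

/-! Appending a digit to x acts linearly on the pair (a(x), s(x)): 0 gives (a, a+s) and 1 gives
(a+s, s). A block 10 is thus a fixed matrix with determinant 1, and its powers have Fibonacci
entries (`stern_sternShift_appendTen`). Alternating digits grow fastest, so a prefix followed by l
free digits has a sharp Fibonacci bound (`sternShift_le_of_div_eq`).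

List the claimed records in increasing order: 1000(10)^{n-1}0, 100100(10)^{n-3}010, then
100(10)^i0(10)^{n-i-1}0 for 1 ≤ i ≤ ⌊n/2⌋, then (10)^{i+1}0(10)^{n-i}. For consecutive entries r <
r', every v < r' satisfies s(v) ≤ s(r) < s(r'). This makes r' a record and leaves no record strictly
between r and r'. The list is entered from (10)^{n+1}, which attains the maximum F(2n+3) over at
most 2n+2 digits, and it ends at the maximum F(2n+4) over at most 2n+3 digits.

To bound s(v) for v < r', look at the first digit where v drops below r'
(`exists_div_eq_of_lt_appendTen`): it is a 0 in place of the 1 of some block 10, and the digits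
after it are free. The strict inequalities s(r) < s(r') rest mostly on `fibGap`. -/

/-- The number whose binary representation is that of `x` followed by `j` copies of `10`. -/
def appendTen : ℕ → ℕ → ℕ
  | 0, x => x
  | j + 1, x => 4 * appendTen j x + 2

@[simp] theorem appendTen_zero (x : ℕ) : appendTen 0 x = x := rfl

theorem appendTen_succ (j x : ℕ) : appendTen (j + 1) x = 4 * appendTen j x + 2 := rfl

/-! ### Fibonacci identities and the gap function. -/

/-- The Fibonacci number `F (2 * j)`. -/
def evenFib (j : ℕ) : ℕ := Nat.fib (2 * j)

/-- The Fibonacci number `F (2 * j - 1)`, with `F (-1) = 1`. -/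
def predFib (j : ℕ) : ℕ := Nat.fib (2 * j + 1) - Nat.fib (2 * j)

theorem fib_two_mul' (j : ℕ) : Nat.fib (2 * j) = evenFib j := rfl

theorem fib_two_mul_add_one' (j : ℕ) : Nat.fib (2 * j + 1) = predFib j + evenFib j := by
  have : Nat.fib (2 * j) ≤ Nat.fib (2 * j + 1) := Nat.fib_le_fib_succ
  unfold predFib evenFib
  omega

theorem fib_two_mul_add_two' (j : ℕ) : Nat.fib (2 * j + 2) = predFib j + 2 * evenFib j := by
  rw [Nat.fib_add_two, fib_two_mul_add_one', fib_two_mul']; ring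

theorem fib_two_mul_add_three' (j : ℕ) :
    Nat.fib (2 * j + 3) = 2 * predFib j + 3 * evenFib j := by
  rw [Nat.fib_add_two, fib_two_mul_add_one', fib_two_mul_add_two']; ring

@[simp] theorem evenFib_zero : evenFib 0 = 0 := rfl

@[simp] theorem predFib_zero : predFib 0 = 1 := rfl

theorem evenFib_succ (j : ℕ) : evenFib (j + 1) = predFib j + 2 * evenFib j :=
  fib_two_mul_add_two' j

theorem predFib_succ (j : ℕ) : predFib (j + 1) = predFib j + evenFib j := by
  have h := fib_two_mul_add_one' (j + 1)
  rw [evenFib_succ, show 2 * (j + 1) + 1 = 2 * j + 3 by ring, fib_two_mul_add_three'] at h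
  omega

theorem predFib_evenFib_add (i j : ℕ) :
    predFib (i + j) = predFib i * predFib j + evenFib i * evenFib j ∧
      evenFib (i + j) = evenFib i * predFib j + (predFib i + evenFib i) * evenFib j := by
  induction j with
  | zero => simp
  | succ j ih =>
    simp only [← add_assoc, predFib_succ, evenFib_succ, ih.1, ih.2]
    constructor <;> ring

theorem predFib_add (i j : ℕ) :
    predFib (i + j) = predFib i * predFib j + evenFib i * evenFib j :=
  (predFib_evenFib_add i j).1

theorem evenFib_add (i j : ℕ) :
    evenFib (i + j) = evenFib i * predFib j + (predFib i + evenFib i) * evenFib j :=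
  (predFib_evenFib_add i j).2

theorem predFib_pos (j : ℕ) : 0 < predFib j := by
  induction j with
  | zero => simp
  | succ j ih => rw [predFib_succ]; omega

theorem evenFib_le_two_mul_predFib (j : ℕ) : evenFib j ≤ 2 * predFib j := by
  cases j with
  | zero => simp
  | succ j => rw [predFib_succ, evenFib_succ]; omega

/-- The integer `F (2 * i - 1) * F (2 * k + 1) - F (2 * i) * F (2 * k)`. -/
def fibGap (i k : ℕ) : ℤ := predFib i * (predFib k + evenFib k) - evenFib i * evenFib k

/-- With M = [[1,1],[1,2]], of determinant 1, `fibGap i k` is the lower right entry of M^(k-i), so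
only k - i matters. -/
theorem fibGap_succ_succ (i k : ℕ) : fibGap (i + 1) (k + 1) = fibGap i k := by
  unfold fibGap
  rw [predFib_succ, evenFib_succ, predFib_succ, evenFib_succ]
  push_cast
  ring

theorem fibGap_add_add (i k d : ℕ) : fibGap (i + d) (k + d) = fibGap i k := by
  induction d with
  | zero => rfl
  | succ d ih => rw [← add_assoc, ← add_assoc, fibGap_succ_succ, ih]

theorem fibGap_pos (i k : ℕ) : 1 ≤ fibGap i k := by
  rcases le_total i k with h | h
  · obtain ⟨d, rfl⟩ := Nat.exists_eq_add_of_le' h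
    have := fibGap_add_add 0 d i
    rw [zero_add] at this
    rw [this]
    have := predFib_pos d
    simp [fibGap]
    omega
  · obtain ⟨d, rfl⟩ := Nat.exists_eq_add_of_le' h
    have := fibGap_add_add d 0 k
    rw [zero_add] at this
    rw [this]
    have := predFib_pos d
    simp [fibGap]
    omega

/-- After shifting so that i = 0, this compares F(2d+1) with F(2d+3), where d = k - i. -/
theorem fibGap_succ_lt {i k : ℕ} (h : i ≤ k) : fibGap (i + 1) k < fibGap i (k + 1) := by
  obtain ⟨d, rfl⟩ := Nat.exists_eq_add_of_le' h
  have h1 := fibGap_add_add 0 (d + 1) i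
  rw [zero_add, add_right_comm] at h1
  have h2 := fibGap_add_add 1 d i
  rw [add_comm 1 i] at h2
  rw [h1, h2]
  have := predFib_pos d
  simp only [fibGap, predFib_succ, evenFib_succ, predFib_zero, evenFib_zero]
  push_cast
  have : (0 : ℤ) < predFib d := by exact_mod_cast this
  have : (0 : ℤ) ≤ evenFib d := by positivity
  linarith

/-! ### Effect of appended digits on the Stern pair. -/

theorem sternShift_two_mul (x : ℕ) : sternShift (2 * x) = stern x + sternShift x :=
  stern_two_mul_add_one x

theorem stern_sternShift_appendTen (j x : ℕ) :
    stern (appendTen j x) = predFib j * stern x + evenFib j * sternShift x ∧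
      sternShift (appendTen j x) =
        evenFib j * stern x + (predFib j + evenFib j) * sternShift x := by
  induction j with
  | zero => simp
  | succ j ih =>
    have e1 : stern (4 * appendTen j x + 2) = stern (appendTen j x) + sternShift (appendTen j x) := by
      rw [show 4 * appendTen j x + 2 = 2 * (2 * appendTen j x + 1) by ring, stern_two_mul,
        stern_two_mul_add_one]
      rfl
    have e2 : sternShift (4 * appendTen j x + 2) =
        stern (appendTen j x) + 2 * sternShift (appendTen j x) := by
      rw [show 4 * appendTen j x + 2 = 2 * (2 * appendTen j x + 1) by ring, sternShift_two_mul,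
        stern_two_mul_add_one, sternShift,
        show 2 * appendTen j x + 1 + 1 = 2 * (appendTen j x + 1) by ring, stern_two_mul, sternShift]
      ring
    rw [appendTen_succ, e1, e2, ih.1, ih.2, predFib_succ, evenFib_succ]
    constructor <;> ring

theorem stern_appendTen (j x : ℕ) :
    stern (appendTen j x) = predFib j * stern x + evenFib j * sternShift x :=
  (stern_sternShift_appendTen j x).1

theorem sternShift_appendTen (j x : ℕ) :
    sternShift (appendTen j x) =
      evenFib j * stern x + (predFib j + evenFib j) * sternShift x :=
  (stern_sternShift_appendTen j x).2

/-- A digit replaces one component by the sum, so bounds on both components and on their sum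
propagate together by the Fibonacci recurrence. -/
theorem stern_sternShift_le_fib {M m : ℕ} (l : ℕ) :
    ∀ v x : ℕ, v / 2 ^ l = x → stern x ≤ M → sternShift x ≤ M →
      stern x + sternShift x ≤ M + m →
      stern v ≤ Nat.fib (l + 1) * M + Nat.fib l * m ∧
      sternShift v ≤ Nat.fib (l + 1) * M + Nat.fib l * m ∧
      stern v + sternShift v ≤ Nat.fib (l + 2) * M + Nat.fib (l + 1) * m := by
  induction l with
  | zero =>
    intro v x hv h1 h2 h3
    rw [pow_zero, Nat.div_one] at hv
    subst hv
    simpa using ⟨h1, h2, h3⟩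
  | succ l ih =>
    intro v x hv h1 h2 h3
    rw [pow_succ', ← Nat.div_div_eq_div_mul] at hv
    obtain ⟨i1, i2, i3⟩ := ih (v / 2) x hv h1 h2 h3
    have hf : Nat.fib (l + 1 + 2) = Nat.fib (l + 1) + Nat.fib (l + 2) := Nat.fib_add_two
    have hf2 : Nat.fib (l + 2) = Nat.fib l + Nat.fib (l + 1) := Nat.fib_add_two
    have hf' : Nat.fib (l + 1 + 1) = Nat.fib (l + 2) := rfl
    rcases Nat.mod_two_eq_zero_or_one v with h | h
    · have hv2 : v = 2 * (v / 2) := by omega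
      have e1 : stern v = stern (v / 2) := by conv_lhs => rw [hv2, stern_two_mul]
      have e2 : sternShift v = stern (v / 2) + sternShift (v / 2) := by
        conv_lhs => rw [hv2, sternShift_two_mul]
      rw [e1, e2, hf, hf']
      refine ⟨by omega, i3, ?_⟩
      rw [hf2] at i3 ⊢
      linarith
    · have hv2 : v = 2 * (v / 2) + 1 := by omega
      have e1 : stern v = stern (v / 2) + sternShift (v / 2) := by
        conv_lhs => rw [hv2, stern_two_mul_add_one]
        rfl
      have e2 : sternShift v = sternShift (v / 2) := by
        conv_lhs => rw [hv2, sternShift, show 2 * (v / 2) + 1 + 1 = 2 * (v / 2 + 1) by ring,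
          stern_two_mul]
        rfl
      rw [e1, e2, hf, hf']
      refine ⟨i3, by omega, ?_⟩
      rw [hf2] at i3 ⊢
      linarith

/-- The largest value of `sternShift` on the numbers whose binary representation is that of `x`,
followed by `0` and `l` further digits. -/
theorem sternShift_le_of_div_eq {v x l : ℕ} (h : v / 2 ^ l = 2 * x) :
    sternShift v ≤ Nat.fib (l + 1) * (stern x + sternShift x) + Nat.fib l * stern x := by
  refine (stern_sternShift_le_fib l v (2 * x) h ?_ ?_ ?_).2.1
  · rw [stern_two_mul]; omega
  · rw [sternShift_two_mul]
  · rw [stern_two_mul, sternShift_two_mul]; omega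

theorem sternShift_le_of_div_odd {v x k : ℕ} (h : v / 2 ^ (2 * k + 1) = 2 * x) :
    sternShift v ≤ (2 * predFib k + 3 * evenFib k) * stern x +
      (predFib k + 2 * evenFib k) * sternShift x := by
  refine (sternShift_le_of_div_eq h).trans_eq ?_
  rw [show 2 * k + 1 + 1 = 2 * k + 2 by ring, fib_two_mul_add_two', fib_two_mul_add_one']
  ring

theorem sternShift_le_of_div_even {v x k : ℕ} (h : v / 2 ^ (2 * k + 2) = 2 * x) :
    sternShift v ≤ (3 * predFib k + 5 * evenFib k) * stern x +
      (2 * predFib k + 3 * evenFib k) * sternShift x := by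
  refine (sternShift_le_of_div_eq h).trans_eq ?_
  rw [show 2 * k + 2 + 1 = 2 * k + 3 by ring, fib_two_mul_add_three', fib_two_mul_add_two']
  ring

theorem sternShift_le_fib_of_lt {v l : ℕ} (h : v < 2 ^ l) : sternShift v ≤ Nat.fib (l + 1) := by
  -- Leading zeros are harmless: the prefix is x = 0, with pair (0, 1).
  have := sternShift_le_of_div_eq (v := v) (x := 0) (l := l) (by simpa using h)
  simpa [stern_zero, stern_one, sternShift] using this

/-- j counts the blocks 10 on which v agrees before it has a 0 instead of a 1; 2k+1 digits then
remain free. -/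
theorem exists_div_eq_of_lt_appendTen {x v m : ℕ} (h : v < appendTen m x) (hx : x * 4 ^ m ≤ v) :
    ∃ j k, j + k + 1 = m ∧ v / 2 ^ (2 * k + 1) = 2 * appendTen j x := by
  induction m generalizing v with
  | zero => simp at h hx; omega
  | succ m ih =>
    rw [appendTen_succ] at h
    rcases Nat.lt_or_ge (v / 4) (appendTen m x) with h1 | h1
    · have hx' : x * 4 ^ m ≤ v / 4 := by
        rw [Nat.le_div_iff_mul_le (by norm_num), mul_assoc, ← pow_succ]
        exact hx
      obtain ⟨j, k, hjk, hv⟩ := ih h1 hx'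
      refine ⟨j, k + 1, by omega, ?_⟩
      rw [← hv, Nat.div_div_eq_div_mul]
      congr 1
      ring
    · exact ⟨m, 0, by omega, by simp; omega⟩

theorem mul_four_pow_le_appendTen (m x : ℕ) : x * 4 ^ m ≤ appendTen m x := by
  induction m with
  | zero => simp
  | succ m ih => rw [appendTen_succ, pow_succ, ← mul_assoc]; omega

theorem appendTen_lt (m x : ℕ) : appendTen m x < (x + 1) * 4 ^ m := by
  induction m with
  | zero => simp
  | succ m ih => rw [appendTen_succ, pow_succ, ← mul_assoc]; omega

/-! ### Values of the candidates and their order. -/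

theorem stern_four : stern 4 = 1 := by simp [stern]

theorem sternShift_four : sternShift 4 = 3 := by simp [sternShift, stern]

theorem stern_eight : stern 8 = 1 := by simp [stern]

theorem sternShift_eight : sternShift 8 = 4 := by simp [sternShift, stern]

theorem stern_thirtySix : stern 36 = 4 := by simp [stern]

theorem sternShift_thirtySix : sternShift 36 = 11 := by simp [sternShift, stern]

theorem sternShift_zero : sternShift 0 = 1 := stern_one

/-- The number with binary representation `100 (10)^i 0 (10)^k 0`. -/
def recordA (i k : ℕ) : ℕ := 2 * appendTen k (2 * appendTen i 4)

/-- The number with binary representation `100 100 (10)^m 0 10`. -/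
def recordC (m : ℕ) : ℕ := 4 * (2 * appendTen m 36) + 2

/-- The number with binary representation `(10)^a 0 (10)^b`. -/
def recordB (a b : ℕ) : ℕ := appendTen b (2 * appendTen a 0)

theorem sternShift_recordA_nat (i k : ℕ) : sternShift (recordA i k) =
    (2 * predFib k + 3 * evenFib k) * stern (appendTen i 4) +
      (predFib k + 2 * evenFib k) * sternShift (appendTen i 4) := by
  rw [recordA, sternShift_two_mul, stern_appendTen, sternShift_appendTen, stern_two_mul,
    sternShift_two_mul]
  ring

theorem sternShift_recordA (i k : ℕ) : (sternShift (recordA i k) : ℤ) =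
    2 * (predFib (i + k + 1) + 2 * evenFib (i + k + 1)) - fibGap i k := by
  rw [sternShift_recordA_nat, stern_appendTen, sternShift_appendTen, stern_four, sternShift_four,
    predFib_succ, evenFib_succ, predFib_add, evenFib_add, fibGap]
  push_cast
  ring

theorem sternShift_recordC (m : ℕ) :
    sternShift (recordC m) = 34 * predFib m + 63 * evenFib m := by
  have : recordC m = appendTen 1 (2 * appendTen m 36) := rfl
  rw [this, sternShift_appendTen, stern_two_mul, sternShift_two_mul, stern_appendTen,
    sternShift_appendTen, stern_thirtySix, sternShift_thirtySix,
    show predFib 1 = 1 from rfl, show evenFib 1 = 1 from rfl]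
  ring

theorem sternShift_recordB (a b : ℕ) : sternShift (recordB a b) =
    evenFib b * evenFib a + (predFib b + evenFib b) * (predFib a + 2 * evenFib a) := by
  rw [recordB, sternShift_appendTen, stern_two_mul, sternShift_two_mul, stern_appendTen,
    sternShift_appendTen, stern_zero, sternShift_zero]
  ring

theorem sternShift_recordB_succ (a b : ℕ) : (sternShift (recordB (a + 1) b) : ℤ) =
    sternShift (recordB a (b + 1)) + fibGap a b := by
  rw [sternShift_recordB, sternShift_recordB, predFib_succ, evenFib_succ, predFib_succ,
    evenFib_succ, fibGap]
  push_cast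
  ring

theorem sternShift_recordB_lt (a b : ℕ) :
    sternShift (recordB a (b + 1)) < sternShift (recordB (a + 1) b) := by
  have := sternShift_recordB_succ a b
  have := fibGap_pos a b
  omega

theorem sternShift_recordB_one_le (a b : ℕ) :
    sternShift (recordB 1 (a + b)) ≤ sternShift (recordB (a + 1) b) := by
  induction a generalizing b with
  | zero => simp
  | succ a ih =>
    refine le_trans ?_ (sternShift_recordB_lt (a + 1) b).le
    rw [show a + 1 + b = a + (b + 1) by ring]
    exact ih (b + 1)

theorem sternShift_recordA_lt {i k : ℕ} (h : i ≤ k) :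
    sternShift (recordA i (k + 1)) < sternShift (recordA (i + 1) k) := by
  have h1 := sternShift_recordA i (k + 1)
  have h2 := sternShift_recordA (i + 1) k
  have := fibGap_succ_lt h
  rw [show i + (k + 1) + 1 = i + 1 + k + 1 by ring] at h1
  omega

/-- The largest value of the records `100 (10)^i 0 (10)^k 0` of a given length. -/
theorem sternShift_recordA_le {i k i' k' : ℕ} (h : i + k = i' + k') (h1 : i' ≤ k' + 1)
    (h2 : k' ≤ i') : sternShift (recordA i k) ≤ sternShift (recordA i' k') := by
  have e1 := sternShift_recordA i k
  have e2 := sternShift_recordA i' k'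
  have e3 : fibGap i' k' = 1 := by
    rcases h2.eq_or_lt with rfl | h2
    · have := fibGap_add_add 0 0 k'
      rw [zero_add] at this
      rw [this]; simp [fibGap]
    · obtain rfl : i' = 1 + k' := by omega
      have := fibGap_add_add 1 0 k'
      rw [zero_add] at this
      rw [this]; simp [fibGap, predFib_succ]
  have := fibGap_pos i k
  rw [h] at e1
  omega

theorem fib_lt_sternShift_recordA_zero (k : ℕ) :
    Nat.fib (2 * (k + 2) + 3) < sternShift (recordA 0 (k + 1)) := by
  rw [sternShift_recordA_nat, fib_two_mul_add_three']
  simp only [appendTen_zero, stern_four, sternShift_four, predFib_succ, evenFib_succ]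
  have := predFib_pos k
  omega

/-- The difference s(`recordC k`) - s(`recordA 0 (k+2)`) is 3(F(2k) - F(2k-1)), positive exactly
from k = 2 on. With k = n - 3 this is the source of n ≥ 5. -/
theorem sternShift_recordA_zero_lt_recordC (m : ℕ) :
    sternShift (recordA 0 (m + 4)) < sternShift (recordC (m + 2)) := by
  rw [sternShift_recordA_nat, sternShift_recordC]
  simp only [appendTen_zero, stern_four, sternShift_four, predFib_succ, evenFib_succ]
  have := predFib_pos m
  omega

theorem sternShift_recordC_lt_recordA_one (m : ℕ) :
    sternShift (recordC m) < sternShift (recordA 1 (m + 1)) := by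
  rw [sternShift_recordA_nat, sternShift_recordC, stern_appendTen, sternShift_appendTen]
  simp only [stern_four, sternShift_four, predFib_succ, evenFib_succ, predFib_zero, evenFib_zero]
  have := predFib_pos m
  omega

theorem sternShift_recordA_lt_recordB (i k : ℕ) :
    sternShift (recordA i k) < sternShift (recordB 1 (i + k + 1)) := by
  have h := sternShift_recordA i k
  have h' := fibGap_pos i k
  rw [sternShift_recordB]
  zify
  rw [h]
  simp only [show predFib 1 = 1 from rfl, show evenFib 1 = 1 from rfl]
  push_cast [predFib_succ, evenFib_succ]
  have := predFib_pos (i + k)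
  omega

/-! ### Bounds for numbers that leave a candidate inside a run of blocks 10. -/

theorem sternShift_le_fib_of_div_eight {v j k : ℕ} (h : v / 2 ^ (2 * k + 2) = 2 * appendTen j 8) :
    sternShift v ≤ Nat.fib (2 * (j + k + 2) + 3) := by
  refine (sternShift_le_of_div_even h).trans ?_
  rw [stern_appendTen, sternShift_appendTen, stern_eight, sternShift_eight, fib_two_mul_add_three']
  simp only [predFib_succ, evenFib_succ, predFib_add, evenFib_add]
  obtain ⟨d, hd⟩ := Nat.exists_eq_add_of_le (evenFib_le_two_mul_predFib j)
  obtain ⟨d', hd'⟩ := Nat.exists_eq_add_of_le (evenFib_le_two_mul_predFib k)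
  generalize predFib j = g at *
  generalize predFib k = g' at *
  generalize evenFib j = e at *
  generalize evenFib k = e' at *
  nlinarith [Nat.zero_le (g * d'), Nat.zero_le (g' * d), Nat.zero_le (d * d'), Nat.zero_le (e * d'), Nat.zero_le (e' * d)]

/-- The ratio F(2j)/F(2j-1) stays below the golden ratio; 5/3 is a sharper rational bound than 2. -/
theorem three_mul_evenFib_le (j : ℕ) : 3 * evenFib j ≤ 5 * predFib j := by
  cases j with
  | zero => simp
  | succ j =>
    have := evenFib_le_two_mul_predFib j
    rw [predFib_succ, evenFib_succ]
    omega

theorem sternShift_le_recordA_zero_of_div {v j k : ℕ}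
    (h : v / 2 ^ (2 * (k + 1) + 2) = 2 * appendTen j 36) :
    sternShift v ≤ sternShift (recordA 0 (j + k + 3)) := by
  refine (sternShift_le_of_div_even h).trans ?_
  rw [sternShift_recordA_nat]
  simp only [stern_appendTen, sternShift_appendTen, stern_thirtySix, sternShift_thirtySix,
    appendTen_zero, stern_four, sternShift_four, predFib_succ, evenFib_succ, predFib_add,
    evenFib_add]
  obtain ⟨d, hd⟩ := Nat.exists_eq_add_of_le (three_mul_evenFib_le j)
  obtain ⟨d', hd'⟩ := Nat.exists_eq_add_of_le (evenFib_le_two_mul_predFib k)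
  generalize predFib j = g at *
  generalize predFib k = g' at *
  generalize evenFib j = e at *
  generalize evenFib k = e' at *
  nlinarith [Nat.zero_le (g * d'), Nat.zero_le (g' * d), Nat.zero_le (g * e'), Nat.zero_le (e' * d)]

theorem sternShift_le_recordA_zero_of_div_two {v m : ℕ}
    (h : v / 2 = 2 * (2 * appendTen (m + 1) 36)) :
    sternShift v ≤ sternShift (recordA 0 (m + 3)) := by
  refine (sternShift_le_of_div_eq (l := 1) (by simpa using h)).trans ?_
  rw [sternShift_recordA_nat, stern_two_mul, sternShift_two_mul]
  simp only [stern_appendTen, sternShift_appendTen, stern_thirtySix, sternShift_thirtySix,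
    appendTen_zero, stern_four, sternShift_four, predFib_succ, evenFib_succ]
  norm_num
  have := evenFib_le_two_mul_predFib m
  omega

theorem sternShift_le_recordA_one_of_div {v i j k : ℕ}
    (h : v / 2 ^ (2 * k + 2) = 2 * appendTen j (2 * appendTen (i + 2) 4)) :
    sternShift v ≤ sternShift (recordA 1 (i + j + k + 2)) := by
  refine (sternShift_le_of_div_even h).trans ?_
  rw [sternShift_recordA_nat]
  rw [stern_appendTen j, sternShift_appendTen j, stern_two_mul, sternShift_two_mul]
  simp only [stern_appendTen, sternShift_appendTen, predFib_zero, evenFib_zero,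
    stern_four, sternShift_four, predFib_succ, evenFib_succ, predFib_add, evenFib_add]
  obtain ⟨d, hd⟩ := Nat.exists_eq_add_of_le (evenFib_le_two_mul_predFib j)
  obtain ⟨d', hd'⟩ := Nat.exists_eq_add_of_le (evenFib_le_two_mul_predFib k)
  obtain ⟨d'', hd''⟩ := Nat.exists_eq_add_of_le (evenFib_le_two_mul_predFib i)
  generalize predFib j = g at *
  generalize predFib k = g' at *
  generalize predFib i = g'' at *
  generalize evenFib j = e at *
  generalize evenFib k = e' at *
  generalize evenFib i = e'' at *
  -- Both sides expand into the same monomials, and the coefficients compare one by one.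
  ring_nf
  gcongr <;> norm_num

theorem sternShift_le_recordB_one_of_div {v a j k : ℕ}
    (h : v / 2 ^ (2 * k + 1) = 2 * appendTen j (2 * appendTen (a + 2) 0)) :
    sternShift v ≤ sternShift (recordB 1 (a + j + k + 2)) := by
  refine (sternShift_le_of_div_odd h).trans ?_
  rw [sternShift_recordB]
  rw [stern_appendTen j, sternShift_appendTen j, stern_two_mul, sternShift_two_mul]
  simp only [stern_appendTen, sternShift_appendTen, stern_zero, sternShift_zero, predFib_zero,
    evenFib_zero, predFib_succ, evenFib_succ, predFib_add, evenFib_add]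
  obtain ⟨d, hd⟩ := Nat.exists_eq_add_of_le (evenFib_le_two_mul_predFib j)
  obtain ⟨d', hd'⟩ := Nat.exists_eq_add_of_le (evenFib_le_two_mul_predFib k)
  obtain ⟨d'', hd''⟩ := Nat.exists_eq_add_of_le (evenFib_le_two_mul_predFib a)
  generalize predFib j = g at *
  generalize predFib k = g' at *
  generalize predFib a = g'' at *
  generalize evenFib j = e at *
  generalize evenFib k = e' at *
  generalize evenFib a = e'' at *
  ring_nf
  gcongr <;> norm_num

/-! ### No value below a candidate exceeds that of its predecessor. -/

theorem IsRecordSetter.eq_of_le {f : ℕ → ℕ} {v r : ℕ} (hv : IsRecordSetter f v) (h : r ≤ v)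
    (h' : f v ≤ f r) : v = r := by
  by_contra hne
  exact absurd (hv r (by omega)) (by omega)

theorem isRecordSetter_of_le_of_lt {f : ℕ → ℕ} {r c : ℕ} (h : ∀ v < r, f v ≤ c) (hc : c < f r) :
    IsRecordSetter f r :=
  fun v hv => (h v hv).trans_lt hc

theorem two_pow_two_mul_add (k l : ℕ) : 2 ^ (2 * k + l) = 4 ^ k * 2 ^ l := by
  rw [pow_add, pow_mul]; norm_num

/-- The bound is the string x 100 (10)^m. The cases are: v has a prefix below x0, v has prefix x0
(where the predecessor of the candidate is maximal), or v agrees through x 100 and drops later. -/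
theorem div_two_pow_of_lt_appendTen {v m x : ℕ} (h : v < appendTen m (2 * (4 * x + 2))) :
    v / 2 ^ (2 * m + 2) < 2 * x ∨ v / 2 ^ (2 * m + 2) = 2 * x ∨
      ∃ j k, j + k + 1 = m ∧ v / 2 ^ (2 * k + 1) = 2 * appendTen j (2 * (4 * x + 2)) := by
  rcases Nat.lt_or_ge v (2 * (4 * x + 2) * 4 ^ m) with h1 | h1
  · have h2 : v / 4 ^ m < 2 * (4 * x + 2) := Nat.div_lt_of_lt_mul (by linarith)
    have h3 : v / 2 ^ (2 * m + 2) = v / 4 ^ m / 4 := by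
      rw [two_pow_two_mul_add, Nat.div_div_eq_div_mul]; norm_num
    rw [h3]
    omega
  · exact Or.inr (Or.inr (exists_div_eq_of_lt_appendTen h h1))

theorem lt_of_div_lt {v m x : ℕ} (h : v / 2 ^ (2 * m) < x) : v < appendTen m x := by
  rw [pow_mul] at h
  norm_num at h
  rw [Nat.div_lt_iff_lt_mul (by positivity)] at h
  exact h.trans_le (mul_four_pow_le_appendTen m x)

theorem sternShift_le_of_lt_recordA_zero {v m : ℕ} (h : v < recordA 0 m) :
    sternShift v ≤ Nat.fib (2 * (m + 1) + 3) := by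
  rcases Nat.lt_or_ge v (2 ^ (2 * (m + 1) + 2)) with h1 | h1
  · exact sternShift_le_fib_of_lt h1
  · rw [recordA, appendTen_zero, show 2 * 4 = 8 from rfl] at h
    rw [two_pow_two_mul_add, pow_succ] at h1
    obtain ⟨j, k, hjk, hv⟩ := exists_div_eq_of_lt_appendTen (x := 8) (v := v / 2) (m := m)
      (by omega) (by omega)
    rw [Nat.div_div_eq_div_mul, ← pow_succ'] at hv
    rw [show 2 * (m + 1) + 3 = 2 * (j + k + 2) + 3 by omega]
    exact sternShift_le_fib_of_div_eight hv

theorem sternShift_le_of_lt_recordC {v m : ℕ} (h : v < recordC (m + 2)) :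
    sternShift v ≤ sternShift (recordA 0 (m + 4)) := by
  have hfib : Nat.fib (2 * (m + 5) + 3) < sternShift (recordA 0 (m + 4)) :=
    fib_lt_sternShift_recordA_zero (m + 3)
  rw [recordC] at h
  rcases Nat.lt_or_ge (v / 8) (36 * 4 ^ (m + 2)) with h1 | h1
  · have h2 : v / 2 ^ (2 * (m + 4) + 1) < 9 := by
      rw [Nat.div_lt_iff_lt_mul (by positivity), two_pow_two_mul_add, pow_succ, pow_succ]
      omega
    rcases (show v / 2 ^ (2 * (m + 4) + 1) < 8 ∨ v / 2 ^ (2 * (m + 4) + 1) = 8 by omega)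
      with h3 | h3
    · refine le_trans (sternShift_le_fib_of_lt (l := 2 * (m + 5) + 2) ?_) hfib.le
      rw [Nat.div_lt_iff_lt_mul (by positivity)] at h3
      refine h3.trans_eq ?_
      ring
    · rw [sternShift_recordA_nat]
      exact sternShift_le_of_div_odd h3
  · rcases Nat.lt_or_ge (v / 8) (appendTen (m + 2) 36) with h2 | h2
    · obtain ⟨j, k, hjk, hv⟩ := exists_div_eq_of_lt_appendTen h2 h1
      rw [show m + 4 = j + k + 3 by omega]
      refine sternShift_le_recordA_zero_of_div (j := j) (k := k) ?_
      rw [← hv, Nat.div_div_eq_div_mul, show 2 * (k + 1) + 2 = 2 * k + 1 + 3 by ring,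
        pow_add 2 (2 * k + 1), mul_comm]
      norm_num
    · have h3 : v / 2 = 2 * (2 * appendTen (m + 2) 36) := by omega
      exact sternShift_le_recordA_zero_of_div_two h3

theorem sternShift_le_of_lt_recordA_one {v m : ℕ} (h : v < recordA 1 (m + 3)) :
    sternShift v ≤ sternShift (recordC (m + 2)) := by
  rcases Nat.lt_or_ge v (recordC (m + 2)) with h1 | h1
  · exact (sternShift_le_of_lt_recordC h1).trans (sternShift_recordA_zero_lt_recordC m).le
  · have h2 : recordA 1 (m + 3) = 2 * (4 * appendTen (m + 2) 36 + 2) := rfl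
    rw [h2] at h
    rw [recordC] at h1
    refine (sternShift_le_of_div_even (k := 0) (x := appendTen (m + 2) 36) ?_).trans_eq ?_
    · norm_num
      omega
    · rw [sternShift_recordC, stern_appendTen, sternShift_appendTen, stern_thirtySix,
        sternShift_thirtySix, predFib_zero, evenFib_zero]
      ring

theorem sternShift_recordA_one_le {i k : ℕ} (h : i ≤ k) :
    sternShift (recordA 1 (i + k)) ≤ sternShift (recordA (i + 1) k) := by
  induction i generalizing k with
  | zero => simp
  | succ i ih =>
    refine le_trans ?_ (sternShift_recordA_lt (i := i + 1) h).le
    rw [show i + 1 + k = i + (k + 1) by ring]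
    exact ih (by omega)

theorem sternShift_le_of_lt_recordA {v i k : ℕ} (hik : i ≤ k)
    (hr : IsRecordSetter sternShift (recordA (i + 1) (k + 1))) (h : v < recordA (i + 2) k) :
    sternShift v ≤ sternShift (recordA (i + 1) (k + 1)) := by
  rw [recordA, appendTen_succ] at h
  have h' : v / 2 < appendTen k (2 * (4 * appendTen (i + 1) 4 + 2)) := by omega
  rcases div_two_pow_of_lt_appendTen h' with h1 | h1 | ⟨j, l, hjl, h1⟩
  · refine (hr v ?_).le
    have := lt_of_div_lt (v := v / 2) (m := k + 1) h1
    rw [recordA]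
    omega
  · rw [Nat.div_div_eq_div_mul, ← pow_succ'] at h1
    rw [sternShift_recordA_nat]
    exact sternShift_le_of_div_odd (k := k + 1) h1
  · rw [Nat.div_div_eq_div_mul, ← pow_succ', ← appendTen_succ] at h1
    refine (sternShift_le_recordA_one_of_div (i := i) h1).trans ?_
    rw [show i + j + l + 2 = i + (k + 1) by omega]
    exact sternShift_recordA_one_le (by omega)

/-- A v with prefix 100(10)^j0 has at most the value of `recordA j l`, and among these the balanced
choice, with i = k or i = k + 1, is largest because its `fibGap` is 1. -/
theorem sternShift_le_of_lt_recordB_one {v i k : ℕ} (h1 : i ≤ k + 1) (h2 : k ≤ i)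
    (h : v < recordB 1 (i + k + 1)) : sternShift v ≤ sternShift (recordA i k) := by
  have hB : recordB 1 (i + k + 1) = appendTen (i + k + 1) 4 := rfl
  rw [hB] at h
  rcases Nat.lt_or_ge v (4 * 4 ^ (i + k + 1)) with h3 | h3
  · have hlt : Nat.fib (2 * (i + k + 1) + 3) ≤ sternShift (recordA i k) := by
      rcases Nat.eq_zero_or_pos (i + k) with h0 | h0
      · obtain ⟨rfl, rfl⟩ : i = 0 ∧ k = 0 := by omega
        simp [recordA, sternShift, stern, Nat.fib]
      · obtain ⟨s, hs⟩ := Nat.exists_eq_add_of_le' h0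
        rw [hs]
        refine (fib_lt_sternShift_recordA_zero s).le.trans ?_
        exact sternShift_recordA_le (by omega) h1 h2
    refine le_trans (sternShift_le_fib_of_lt (l := 2 * (i + k + 1) + 2) ?_) hlt
    rw [two_pow_two_mul_add]
    omega
  · obtain ⟨j, l, hjl, hv⟩ := exists_div_eq_of_lt_appendTen h h3
    refine (sternShift_le_of_div_odd hv).trans ?_
    rw [← sternShift_recordA_nat]
    exact sternShift_recordA_le (by omega) h1 h2

theorem sternShift_le_of_lt_recordB {v a b : ℕ}
    (hr : IsRecordSetter sternShift (recordB (a + 1) (b + 1))) (h : v < recordB (a + 2) b) :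
    sternShift v ≤ sternShift (recordB (a + 1) (b + 1)) := by
  rw [recordB, appendTen_succ] at h
  rcases div_two_pow_of_lt_appendTen h with h1 | h1 | ⟨j, l, hjl, h1⟩
  · exact (hr v (lt_of_div_lt (m := b + 1) h1)).le
  · refine (sternShift_le_of_div_even h1).trans_eq ?_
    rw [sternShift_recordB, stern_appendTen, sternShift_appendTen, stern_zero, sternShift_zero]
    simp only [predFib_succ, evenFib_succ]
    ring
  · rw [← appendTen_succ] at h1
    refine (sternShift_le_recordB_one_of_div (a := a) h1).trans ?_
    rw [show a + j + l + 2 = a + (b + 1) by omega]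
    exact sternShift_recordB_one_le a (b + 1)

theorem sternShift_le_recordB_of_lt {v a : ℕ} (h : v < 2 ^ (2 * a + 1)) :
    sternShift v ≤ sternShift (recordB a 0) := by
  refine (sternShift_le_fib_of_lt h).trans_eq ?_
  rw [show 2 * a + 1 + 1 = 2 * a + 2 by ring, fib_two_mul_add_two', sternShift_recordB]
  simp

/-! ### The candidates are records, and there are no others. -/

theorem isRecordSetter_recordA_zero (m : ℕ) : IsRecordSetter sternShift (recordA 0 (m + 1)) :=
  isRecordSetter_of_le_of_lt (fun _ => sternShift_le_of_lt_recordA_zero)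
    (fib_lt_sternShift_recordA_zero m)

theorem isRecordSetter_recordC (m : ℕ) : IsRecordSetter sternShift (recordC (m + 2)) :=
  isRecordSetter_of_le_of_lt (fun _ => sternShift_le_of_lt_recordC)
    (sternShift_recordA_zero_lt_recordC m)

theorem isRecordSetter_recordA {i k : ℕ} (hik : i ≤ k) (h : 3 ≤ i + k) :
    IsRecordSetter sternShift (recordA (i + 1) k) := by
  induction i generalizing k with
  | zero =>
    obtain ⟨m, rfl⟩ := Nat.exists_eq_add_of_le' (show 3 ≤ k by omega)
    exact isRecordSetter_of_le_of_lt (fun _ => sternShift_le_of_lt_recordA_one)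
      (sternShift_recordC_lt_recordA_one (m + 2))
  | succ i ih =>
    exact isRecordSetter_of_le_of_lt
      (fun _ => sternShift_le_of_lt_recordA (by omega) (ih (by omega) (by omega)))
      (sternShift_recordA_lt hik)

theorem isRecordSetter_recordB (a b : ℕ) (h : 1 ≤ a + b) :
    IsRecordSetter sternShift (recordB (a + 1) b) := by
  induction a generalizing b with
  | zero =>
    obtain ⟨i, k, h1, h2, rfl⟩ : ∃ i k, i ≤ k + 1 ∧ k ≤ i ∧ b = i + k + 1 :=
      ⟨b / 2, b - 1 - b / 2, by omega, by omega, by omega⟩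
    exact isRecordSetter_of_le_of_lt (fun _ => sternShift_le_of_lt_recordB_one h1 h2)
      (sternShift_recordA_lt_recordB i k)
  | succ a ih =>
    exact isRecordSetter_of_le_of_lt
      (fun _ => sternShift_le_of_lt_recordB (ih (b + 1) (by omega)))
      (sternShift_recordB_lt (a + 1) b)

/-- The record-setters of `sternShift` with `2 * n + 3` binary digits, where `n = m + 5`. -/
theorem IsRecordSetter.eq_record {v m : ℕ} (hv : IsRecordSetter sternShift v)
    (h1 : 2 ^ (2 * (m + 5) + 2) ≤ v) (h2 : v < 2 ^ (2 * (m + 5) + 3)) :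
    v = recordA 0 (m + 4) ∨ v = recordC (m + 2) ∨ v = recordA 1 (m + 3) ∨
      (∃ i k, 1 < i ∧ 2 * i ≤ m + 5 ∧ i + k = m + 4 ∧ v = recordA i k) ∨
      ∃ i k, i + k = m + 5 ∧ v = recordB (i + 1) k := by
  by_contra! hne
  obtain ⟨hA0, hC, hA1, hA, hB⟩ := hne
  have step : ∀ r r', r ≤ v → v ≠ r → (v < r' → sternShift v ≤ sternShift r) → r' ≤ v := by
    intro r r' hr hne h
    by_contra! hlt
    exact hne (hv.eq_of_le hr (h hlt))
  have s0 : recordA 0 (m + 4) ≤ v := by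
    -- This is (10)^{n+1} with n = m + 5, of length 2n+2 and value F(2n+3).
    refine step (appendTen (m + 6) 0) _ ?_ ?_ fun h => ?_
    · have := appendTen_lt (m + 6) 0
      rw [two_pow_two_mul_add, pow_succ] at h1
      rw [pow_succ, pow_succ] at this
      omega
    · have := appendTen_lt (m + 6) 0
      rw [two_pow_two_mul_add] at h1
      rw [pow_succ] at this
      omega
    · refine (sternShift_le_of_lt_recordA_zero h).trans_eq ?_
      rw [sternShift_appendTen, stern_zero, sternShift_zero, ← fib_two_mul_add_one']
      ring_nf
  have s1 : recordC (m + 2) ≤ v := step _ _ s0 hA0 sternShift_le_of_lt_recordC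
  have s2 : recordA 1 (m + 3) ≤ v := step _ _ s1 hC sternShift_le_of_lt_recordA_one
  have s3 : ∀ i k, i ≤ k → i + k = m + 3 → recordA (i + 1) k ≤ v := by
    intro i
    induction i with
    | zero => intro k _ hk; rw [show k = m + 3 by omega]; exact s2
    | succ i ih =>
      intro k hik hk
      refine step _ _ (ih (k + 1) (by omega) (by omega)) ?_
        (sternShift_le_of_lt_recordA (by omega) (isRecordSetter_recordA (by omega) (by omega)))
      cases i with
      | zero => rw [show k + 1 = m + 3 by omega]; exact hA1
      | succ i => exact hA _ _ (by omega) (by omega) (by omega)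
  have s4 : ∀ i k, i + k = m + 5 → recordB (i + 1) k ≤ v := by
    intro i
    induction i with
    | zero =>
      intro k hk
      -- The predecessor of `recordB 1 n` is the balanced `recordA`, with first index ⌊n/2⌋ ≥ 2.
      obtain ⟨i, l, h3, h4, rfl⟩ : ∃ i l, i + 1 ≤ l + 1 ∧ l ≤ i + 1 ∧ k = i + 1 + l + 1 :=
        ⟨k / 2 - 1, k - 1 - k / 2, by omega, by omega, by omega⟩
      exact step _ _ (s3 i l (by omega) (by omega)) (hA _ _ (by omega) (by omega) (by omega))
        (sternShift_le_of_lt_recordB_one h3 h4)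
    | succ i ih =>
      intro k hk
      exact step _ _ (ih (k + 1) (by omega)) (hB _ _ (by omega))
        (sternShift_le_of_lt_recordB (isRecordSetter_recordB _ _ (by omega)))
  exact hB (m + 5) 0 (by omega) (hv.eq_of_le (s4 _ _ (by omega)) (sternShift_le_recordB_of_lt h2))

/-! ### Translation to binary strings. -/

theorem binaryString_two_mul {x : ℕ} (hx : x ≠ 0) :
    binaryString (2 * x) = binaryString x ++ [0] := by
  have := Nat.digits_add_two_add_one 0 (2 * x - 1)
  rw [show 2 * x - 1 + 1 = 2 * x by omega] at this
  simp [binaryString, this]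

theorem binaryString_two_mul_add_one (x : ℕ) :
    binaryString (2 * x + 1) = binaryString x ++ [1] := by
  simp [binaryString]
  omega

theorem binaryString_appendTen (j x : ℕ) :
    binaryString (appendTen j x) = binaryString x ++ strPow [1, 0] j := by
  induction j with
  | zero => simp [strPow]
  | succ j ih =>
    rw [appendTen_succ, show 4 * appendTen j x + 2 = 2 * (2 * appendTen j x + 1) by ring,
      binaryString_two_mul (by omega), binaryString_two_mul_add_one, ih]
    simp [strPow, List.replicate_succ']

theorem length_strPow (x : List ℕ) (j : ℕ) : (strPow x j).length = j * x.length := by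
  simp [strPow]

theorem appendTen_ne_zero {x : ℕ} (j : ℕ) (hx : x ≠ 0) : appendTen j x ≠ 0 := by
  have := mul_four_pow_le_appendTen j x
  have : 0 < x * 4 ^ j := by positivity
  omega

theorem binaryString_recordA (i k : ℕ) : binaryString (recordA i k) =
    [1, 0, 0] ++ strPow [1, 0] i ++ [0] ++ strPow [1, 0] k ++ [0] := by
  have h := appendTen_ne_zero i (x := 4) (by norm_num)
  rw [recordA, binaryString_two_mul (appendTen_ne_zero k (by omega)), binaryString_appendTen,
    binaryString_two_mul h, binaryString_appendTen]
  simp [binaryString]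

theorem binaryString_recordC (m : ℕ) : binaryString (recordC m) =
    [1, 0, 0, 1, 0, 0] ++ strPow [1, 0] m ++ [0] ++ [1, 0] := by
  have h := appendTen_ne_zero m (x := 36) (by norm_num)
  have : recordC m = appendTen 1 (2 * appendTen m 36) := rfl
  rw [this, binaryString_appendTen, binaryString_two_mul h, binaryString_appendTen]
  simp [binaryString, strPow]

theorem binaryString_recordB (a b : ℕ) : binaryString (recordB (a + 1) b) =
    strPow [1, 0] (a + 1) ++ [0] ++ strPow [1, 0] b := by
  rw [recordB, binaryString_appendTen, binaryString_two_mul (by rw [appendTen_succ]; omega),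
    binaryString_appendTen]
  simp [binaryString]

theorem ceil_sub_one_div_two (n : ℕ) : ⌈((n : ℚ) - 1) / 2⌉ = ((n / 2 : ℕ) : ℤ) := by
  rw [Int.ceil_eq_iff]
  rcases Nat.even_or_odd' n with ⟨k, rfl | rfl⟩
  · rw [show 2 * k / 2 = k by omega]
    push_cast
    constructor <;> linarith
  · rw [show (2 * k + 1) / 2 = k by omega]
    push_cast
    constructor <;> linarith

theorem mainTheorem3 (n : ℕ) (hn : 5 ≤ n) (w : List ℕ) :
    (∃ v : ℕ, IsRecordSetter sternShift v ∧ binaryString v = w ∧ w.length = 2 * n + 3) ↔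
      w = [1, 0, 0, 0] ++ strPow [1, 0] (n - 1) ++ [0] ∨
      w = [1, 0, 0, 1, 0, 0] ++ strPow [1, 0] (n - 3) ++ [0] ++ [1, 0] ∨
      w = [1, 0, 0, 1, 0, 0] ++ strPow [1, 0] (n - 2) ++ [0] ∨
      (∃ i : ℕ, 1 < i ∧ (i : ℤ) ≤ ⌈((n : ℚ) - 1) / 2⌉ ∧
        w = [1, 0, 0] ++ strPow [1, 0] i ++ [0] ++ strPow [1, 0] (n - i - 1) ++ [0]) ∨
      (∃ i : ℕ, i ≤ n ∧
        w = strPow [1, 0] (i + 1) ++ [0] ++ strPow [1, 0] (n - i)) := by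
  obtain ⟨m, rfl⟩ := Nat.exists_eq_add_of_le' hn
  rw [ceil_sub_one_div_two]
  have e0 : [1, 0, 0, 0] ++ strPow [1, 0] (m + 5 - 1) ++ [0] =
      binaryString (recordA 0 (m + 4)) := by
    rw [binaryString_recordA]; rfl
  have e1 : [1, 0, 0, 1, 0, 0] ++ strPow [1, 0] (m + 5 - 3) ++ [0] ++ [1, 0] =
      binaryString (recordC (m + 2)) := by
    rw [binaryString_recordC]; rfl
  have e2 : [1, 0, 0, 1, 0, 0] ++ strPow [1, 0] (m + 5 - 2) ++ [0] =
      binaryString (recordA 1 (m + 3)) := by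
    rw [binaryString_recordA]; rfl
  constructor
  · rintro ⟨v, hv, rfl, hlen⟩
    rw [binaryString, List.length_reverse] at hlen
    have hv0 : v ≠ 0 := by
      rintro rfl
      simp at hlen
    have h1 := Nat.base_pow_length_digits_le 2 v (by norm_num) hv0
    have h2 := Nat.lt_base_pow_length_digits (b := 2) (m := v) (by norm_num)
    rw [hlen] at h1 h2
    rw [pow_succ'] at h1
    rw [e0, e1, e2]
    rcases hv.eq_record (m := m) (by omega) h2 with
      h | h | h | ⟨i, k, h3, h4, h5, h⟩ | ⟨i, k, h3, h⟩
    · exact Or.inl (by rw [h])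
    · exact Or.inr (Or.inl (by rw [h]))
    · exact Or.inr (Or.inr (Or.inl (by rw [h])))
    · refine Or.inr (Or.inr (Or.inr (Or.inl ⟨i, h3, by omega, ?_⟩)))
      rw [h, binaryString_recordA, show m + 5 - i - 1 = k by omega]
    · refine Or.inr (Or.inr (Or.inr (Or.inr ⟨i, by omega, ?_⟩)))
      rw [h, binaryString_recordB, show m + 5 - i = k by omega]
  · rintro (rfl | rfl | rfl | ⟨i, h1, h2, rfl⟩ | ⟨i, h1, rfl⟩)
    · refine ⟨_, isRecordSetter_recordA_zero (m + 3), e0.symm, ?_⟩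
      simp [length_strPow]; omega
    · refine ⟨_, isRecordSetter_recordC m, e1.symm, ?_⟩
      simp [length_strPow]; omega
    · refine ⟨_, isRecordSetter_recordA (i := 0) (by omega) (by omega), e2.symm, ?_⟩
      simp [length_strPow]; omega
    · obtain ⟨i, rfl⟩ := Nat.exists_eq_add_of_lt h1
      refine ⟨_, isRecordSetter_recordA (by omega) (by omega), binaryString_recordA _ _, ?_⟩
      simp [length_strPow]; omega
    · refine ⟨_, isRecordSetter_recordB _ _ (by omega), binaryString_recordB _ _, ?_⟩
      simp [length_strPow]; omega
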